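/- **Setup.** Let $\mathcal Q=\bigoplus_{n\ge 0}\mathcal Q_n$ be the real vector space of quasisymmetric functions in $x_1,x_2,\dots$, where $\mathcal Q_n$ is spanned by $M_\alpha=\sum_{i_1<\cdots<i_k}x_{i_1}^{a_1}\cdots x_{i_k}^{a_k}$ for compositions $\alpha=(a_1,\dots,a_k)$ of $n$. Write $S_\alpha=\{a_1,a_1+a_2,\dots,a_1+\cdots+a_{k-1}\}\subseteq[n-1]$, let $\mathrm{co}$ be the inverse of the bijection $\alpha\mapsto S_\alpha$, and let $F_\alpha=\sum_{S_\beta\supseteq S_\alpha}M_\beta$ (sum over compositions $\beta$ of $n$) be the fundamental basis. For a sequence $w=(w_1,\dots,w_n)$ of distinct integers (in particular for a permutation $\sigma=(\sigma_1,\dots,\sigma_n)\in\mathfrak S_n$ in one-line notation), the descent composition is $D(w)=\mathrm{co}(\{i\in[n-1]: w_i>w_{i+1}\})$, and the standardization $\mathrm{st}(w)$ is the unique permutation whose entries are in the same relative order as those of $w$. Products of permutations are compositions: $(\sigma\pi)(i)=\sigma(\pi(i))$. For a graded linear operator $\Phi$ on $\mathcal Q$ write $\Phi(F_\alpha)=\sum_\beta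 c_{\alpha,\beta}F_\beta$ and $\Phi(M_{(1)})=\lambda M_{(1)}$. Put $\overline K^{\Phi}_n(\alpha,\beta)=\lambda^{-n}c_{\alpha,\beta}$ for compositions $\alpha,\beta$ of $n$, and let $K^\Phi_n$ be the matrix indexed by $\mathfrak S_n$ with $$K^\Phi_n(\pi,\rho\pi)=\mathrm{Prob}_\Phi(\rho^{-1}),\qquad \mathrm{Prob}_\Phi(\pi)=\frac{c_{D(\pi),(n)}}{\sum_{\sigma\in\mathfrak S_n}c_{D(\sigma),(n)}},$$ where $(n)=\mathrm{co}(\emptyset)$ (the empty composition if $n=0$). For real $r$, let $\omega_r$ be the linear operator on the span of the words in two noncommuting letters $a,b$ that replaces each factor $ab$ of a word by $r(ab+(r-1)ba)$, each remaining $a$ by $a+(r-1)b$, and each remaining $b$ by $b+(r-1)a$. Let $\gamma$ send a word $u$ of length $n-1$ to $F_{\mathrm{co}(S_u)}\in\mathcal Q_n$, where $S_u\subseteq[n-1]$ is the set of positions of $b$ in $u$. Let $\vartheta_r$ be the linear operator on $\mathcal Q$ with $\vartheta_r(1)=1$ and $\vartheta_r(F)=\gamma(r\,\omega_r(\gamma^{-1}(F)))$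 for $F\in\bigoplus_{n\ge1}\mathcal Q_n$. **Theorem.** Let $n\ge 0$, let $r>1$ be real, and let $\delta_1,\dots,\delta_n$ be independent random variables with $\mathrm{Prob}(\delta_i=1)=\frac1r$ and $\mathrm{Prob}(\delta_i=-1)=1-\frac1r$. Then for all $\sigma,\tau\in\mathfrak S_n$ and every composition $\beta$ of $n$, $$K^{\vartheta_r}_n(\sigma,\tau)=\mathrm{Prob}\big(\mathrm{st}(\delta_1\sigma_1,\dots,\delta_n\sigma_n)=\tau\big),$$ $$\overline K^{\vartheta_r}_n(D(\sigma),\beta)=\mathrm{Prob}\big(D(\delta_1\sigma_1,\dots,\delta_n\sigma_n)=\beta\big).$$ For $r=2$ this recovers Stembridge's theorem: if $r=2$, then $$\overline K^{\Theta}_n(D(\sigma),\beta)=\mathrm{Prob}\big(D(\delta_1\sigma_1,\dots,\delta_n\sigma_n)=\beta\big),$$ where $\Theta$ is Stembridge's operator, given by $\Theta(1)=1$ and, for a composition $\alpha$ of $n\ge1$, $$\Theta(F_\alpha)=2^{|\Lambda(\alpha)|+1}\sum_{\beta:\ \Lambda(\alpha)\subseteq S_\beta\,\triangle\,(S_\beta+1)}F_\beta,\qquad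 \Lambda(\alpha)=\{i\in S_\alpha: i\ne1,\ i-1\notin S_\alpha\}.$$ -/

import Mathlib

open MeasureTheory ProbabilityTheory

noncomputable section

namespace QuasiSym

/-! ### Compositions and descents

An index `i : Fin (n - 1)` stands for the element `i + 1` of `[n - 1] = {1, …, n - 1}`. -/

/-- The bijection `α ↦ S_α` between compositions of `n` and subsets of `[n - 1]`, where `S_α` is
the set of proper partial sums `a₁, a₁ + a₂, …` of `α`. -/
def cutSet (n : ℕ) : Composition n ≃ Finset (Fin (n - 1)) :=
  (compositionEquiv n).trans (compositionAsSetEquiv n)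

/-- The inverse bijection `S ↦ co(S)`. -/
def co (n : ℕ) (S : Finset (Fin (n - 1))) : Composition n := (cutSet n).symm S

/-- The composition `(n)` of `n` with the empty set of cuts; for `n = 0` it is the empty
composition. -/
def onePart (n : ℕ) : Composition n := co n ∅

/-- The descent set of a sequence `(w₁, …, wₙ)`. -/
def descents {X : Type*} [LinearOrder X] {n : ℕ} (w : Fin n → X) : Finset (Fin (n - 1)) :=
  Finset.univ.filter fun i => w ⟨(i : ℕ) + 1, by omega⟩ < w ⟨(i : ℕ), by omega⟩

/-- The descent composition of a sequence `(w₁, …, wₙ)`. -/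
def descentComp {X : Type*} [LinearOrder X] {n : ℕ} (w : Fin n → X) : Composition n :=
  co n (descents w)

/-- The descent composition `D(σ)` of a permutation. -/
def D {n : ℕ} (σ : Equiv.Perm (Fin n)) : Composition n := descentComp fun i => σ i

/-- The standardization of a sequence (equal entries, if any, are ranked from left to right). -/
def st {X : Type*} [LinearOrder X] {n : ℕ} (w : Fin n → X) : Equiv.Perm (Fin n) :=
  (Tuple.sort w)⁻¹

/-- For a sequence of distinct entries, `st w` is the unique permutation whose entries are in the
same relative order as those of `w`. -/
theorem st_eq_iff {X : Type*} [LinearOrder X] {n : ℕ} {w : Fin n → X}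
    (hw : Function.Injective w) (τ : Equiv.Perm (Fin n)) :
    st w = τ ↔ ∀ i j, w i < w j ↔ τ i < τ j := by
  have hs : StrictMono (w ∘ Tuple.sort w) :=
    (Tuple.monotone_sort w).strictMono_of_injective (hw.comp (Tuple.sort w).injective)
  constructor
  · rintro rfl i j
    have := hs.lt_iff_lt (a := (Tuple.sort w)⁻¹ i) (b := (Tuple.sort w)⁻¹ j)
    simpa [st] using this
  · intro h
    have hm : Monotone (w ∘ (τ⁻¹ : Equiv.Perm (Fin n))) := by
      intro i j hij
      by_contra hlt
      have := (h _ _).1 (not_le.1 hlt)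
      simp at this
      exact absurd hij (not_le.2 this)
    have h2 := Tuple.unique_monotone hm (Tuple.monotone_sort w)
    have h3 : (τ⁻¹ : Equiv.Perm (Fin n)) = Tuple.sort w := by
      ext i
      exact congrArg Fin.val (hw (congrFun h2 i))
    rw [st, ← h3, inv_inv]

/-- The sequence `(δ₁ σ₁, …, δₙ σₙ)`, where `σᵢ ∈ {1, …, n}`. -/
def signedSeq {n : ℕ} (δ : Fin n → ℤ) (σ : Equiv.Perm (Fin n)) : Fin n → ℤ :=
  fun i => δ i * (((σ i : ℕ) : ℤ) + 1)

/-! ### Quasisymmetric functions -/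

/-- Compositions of all natural numbers. -/
abbrev Comp : Type := Σ n : ℕ, Composition n

/-- The nonzero exponents of a monomial, in the order of the variables. -/
def exponents (m : ℕ →₀ ℕ) : List ℕ := (m.support.sort (· ≤ ·)).map m

/-- The monomial quasisymmetric function `M_α = ∑_{i₁ < ⋯ < iₖ} x_{i₁}^{a₁} ⋯ x_{iₖ}^{aₖ}`,
as a power series in the variables `x₀, x₁, …`. -/
def monoSeries (α : Comp) : MvPowerSeries ℕ ℝ :=
  fun m => if exponents m = α.2.blocks then 1 else 0

/-- The space of quasisymmetric functions, the linear span of the `M_α`. -/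
def QSym : Submodule ℝ (MvPowerSeries ℕ ℝ) := Submodule.span ℝ (Set.range monoSeries)

/-- `M_α` as an element of the space of quasisymmetric functions. -/
def M (α : Comp) : QSym := ⟨monoSeries α, Submodule.subset_span ⟨α, rfl⟩⟩

/-- The fundamental quasisymmetric function `F_α`, the sum of the `M_β` over the refinements `β`
of `α`. -/
def F (α : Comp) : QSym :=
  ∑ β : Composition α.1 with cutSet α.1 α.2 ⊆ cutSet α.1 β, M ⟨α.1, β⟩

/-- The monomial `x₀^{a₁} ⋯ x_{k-1}^{aₖ}`. -/
def leadMonomial (α : Comp) : ℕ →₀ ℕ :=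
  Finsupp.onFinset (Finset.range α.2.blocks.length) (fun i => α.2.blocks.getD i 0) (by
    intro i hi
    by_contra h
    simp at h
    exact hi (List.getD_eq_default _ _ h))

theorem exponents_leadMonomial (α : Comp) : exponents (leadMonomial α) = α.2.blocks := by
  have hs : (leadMonomial α).support = Finset.range α.2.blocks.length := by
    ext i
    simp only [leadMonomial, Finsupp.mem_support_iff, Finsupp.onFinset_apply, Finset.mem_range]
    constructor
    · intro hi
      by_contra h
      exact hi (List.getD_eq_default _ _ (not_lt.1 h))
    · intro hi
      rw [List.getD_eq_getElem _ _ hi]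
      exact (α.2.blocks_pos (List.getElem_mem hi)).ne'
  rw [exponents, hs, Finset.sort_range]
  apply List.ext_getElem
  · simp
  · intro i h1 h2
    simp [leadMonomial, h2]

theorem Comp.ext_blocks {α β : Comp} (h : α.2.blocks = β.2.blocks) : α = β := by
  obtain ⟨n, a⟩ := α
  obtain ⟨m, b⟩ := β
  have hn : n = m := by rw [← a.blocks_sum, ← b.blocks_sum]; exact congrArg List.sum h
  subst hn
  congr 1
  exact Composition.ext h

/-- The coefficient of `M_α`, as a linear functional. -/
def monoCoeff (α : Comp) : QSym →ₗ[ℝ] ℝ :=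
  (MvPowerSeries.coeff (leadMonomial α)).comp QSym.subtype

theorem monoCoeff_M (α β : Comp) : monoCoeff α (M β) = if α = β then 1 else 0 := by
  show monoSeries β (leadMonomial α) = _
  simp only [monoSeries, exponents_leadMonomial]
  by_cases h : α = β
  · subst h; simp
  · rw [if_neg (fun hb => h (Comp.ext_blocks hb)), if_neg h]

theorem monoCoeff_F (n : ℕ) (γ : Composition n) (α : Comp) :
    monoCoeff ⟨n, γ⟩ (F α) =
      if ∃ h : α.1 = n, cutSet n (h ▸ α.2) ⊆ cutSet n γ then 1 else 0 := by
  obtain ⟨m, a⟩ := α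
  simp only [F, map_sum, monoCoeff_M]
  by_cases h : m = n
  · subst h
    simp [Finset.sum_ite_eq]
  · rw [if_neg (by rintro ⟨h', -⟩; exact h h')]
    apply Finset.sum_eq_zero
    intro b _
    rw [if_neg]
    intro h'
    exact h (congrArg Sigma.fst h').symm

theorem F_linearIndependent : LinearIndependent ℝ F := by
  rw [linearIndependent_iff]
  intro l hl
  by_contra hne
  obtain ⟨α, hα, hmin⟩ := Finset.exists_min_image l.support
    (fun α : Comp => (cutSet α.1 α.2).card) (Finsupp.support_nonempty_iff.2 hne)
  have h0 := congrArg (monoCoeff α) hl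
  rw [Finsupp.linearCombination_apply, Finsupp.sum, map_sum, map_zero,
    Finset.sum_eq_single α] at h0
  · obtain ⟨n, a⟩ := α
    rw [map_smul, monoCoeff_F, if_pos ⟨rfl, subset_rfl⟩] at h0
    simp only [smul_eq_mul, mul_one] at h0
    exact Finsupp.mem_support_iff.1 hα h0
  · intro β hβ hβα
    obtain ⟨n, a⟩ := α
    rw [map_smul, monoCoeff_F, if_neg, smul_zero]
    rintro ⟨h, hsub⟩
    obtain ⟨m, b⟩ := β
    dsimp at h
    subst h
    apply hβα
    congr 1
    exact (cutSet _).injective (Finset.eq_of_subset_of_card_le hsub (hmin _ hβ))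
  · intro h
    exact absurd hα h

theorem M_mem_span_F (n : ℕ) (k : ℕ) (α : Composition n)
    (hk : n - 1 - (cutSet n α).card = k) : M ⟨n, α⟩ ∈ Submodule.span ℝ (Set.range F) := by
  induction k using Nat.strong_induction_on generalizing α with
  | _ k ih =>
    have hF : F ⟨n, α⟩ = M ⟨n, α⟩ +
        ∑ β ∈ (Finset.univ.filter fun β : Composition n => cutSet n α ⊆ cutSet n β).erase α,
          M ⟨n, β⟩ := by
      rw [Finset.add_sum_erase _ (fun β => M ⟨n, β⟩) (by simp)]
      rfl
    replace hF := eq_sub_of_add_eq hF.symm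
    rw [hF]
    refine Submodule.sub_mem _ (Submodule.subset_span ⟨_, rfl⟩) (Submodule.sum_mem _ ?_)
    intro β hβ
    simp only [Finset.mem_erase, Finset.mem_filter, Finset.mem_univ, true_and] at hβ
    have hlt : (cutSet n α).card < (cutSet n β).card :=
      Finset.card_lt_card (hβ.2.ssubset_of_ne fun h => hβ.1 ((cutSet n).injective h).symm)
    have hle : (cutSet n β).card ≤ n - 1 := by
      simpa using Finset.card_le_univ (cutSet n β)
    exact ih _ (by omega) β rfl

theorem F_span : ⊤ ≤ Submodule.span ℝ (Set.range F) := by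
  rintro ⟨f, hf⟩ -
  have key : ∀ f (hf : f ∈ QSym), (⟨f, hf⟩ : QSym) ∈ Submodule.span ℝ (Set.range F) := by
    intro f hf
    induction hf using Submodule.span_induction with
    | mem x hx =>
      obtain ⟨α, rfl⟩ := hx
      exact M_mem_span_F α.1 _ α.2 rfl
    | zero => exact Submodule.zero_mem _
    | add x y hx hy h1 h2 => exact Submodule.add_mem _ h1 h2
    | smul a x hx h => exact Submodule.smul_mem _ a h
  exact key f hf

/-- The basis of fundamental quasisymmetric functions. -/
def basisF : Module.Basis Comp ℝ QSym := Module.Basis.mk F_linearIndependent F_span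

/-! ### Transition matrices associated with an operator on quasisymmetric functions -/

/-- The number `c_{α,β}` in `Φ(F_α) = ∑_β c_{α,β} F_β`. -/
def c (Φ : QSym →ₗ[ℝ] QSym) (n : ℕ) (α β : Composition n) : ℝ :=
  basisF.repr (Φ (F ⟨n, α⟩)) ⟨n, β⟩

/-- The probability `Prob_Φ(π) = c_{D(π),n} / ∑_σ c_{D(σ),n}`. -/
def prob (Φ : QSym →ₗ[ℝ] QSym) (n : ℕ) (π : Equiv.Perm (Fin n)) : ℝ :=
  c Φ n (D π) (onePart n) / ∑ σ : Equiv.Perm (Fin n), c Φ n (D σ) (onePart n)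

/-- The transition matrix of the walk moving `π` to `ρ π` with probability `Prob_Φ(ρ⁻¹)`;
here `τ = ρ π`. -/
def K (Φ : QSym →ₗ[ℝ] QSym) (n : ℕ) (π τ : Equiv.Perm (Fin n)) : ℝ :=
  prob Φ n (τ * π⁻¹)⁻¹

/-- The scalar `λ` with `Φ(M₁) = λ M₁`. -/
def lam (Φ : QSym →ₗ[ℝ] QSym) : ℝ := basisF.repr (Φ (M ⟨1, onePart 1⟩)) ⟨1, onePart 1⟩

theorem M_one_eq_F_one : M ⟨1, onePart 1⟩ = F ⟨1, onePart 1⟩ := by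
  have : Subsingleton (Finset (Fin (1 - 1))) := inferInstanceAs (Subsingleton (Finset (Fin 0)))
  have : Subsingleton (Composition 1) := (cutSet 1).subsingleton
  simp only [F]
  rw [Finset.sum_eq_single (onePart 1)]
  · intro b _ hb
    exact absurd (Subsingleton.elim _ _) hb
  · intro h
    simp at h

theorem lam_eq {Φ : QSym →ₗ[ℝ] QSym} {a : ℝ}
    (h : Φ (M ⟨1, onePart 1⟩) = a • M ⟨1, onePart 1⟩) : lam Φ = a := by
  rw [lam, h, M_one_eq_F_one, map_smul]
  have : F ⟨1, onePart 1⟩ = basisF ⟨1, onePart 1⟩ := by simp [basisF]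
  rw [this]
  simp

/-- The matrix `K̄(α, β) = λ⁻ⁿ c_{α,β}`. -/
def Kbar (Φ : QSym →ₗ[ℝ] QSym) (n : ℕ) (α β : Composition n) : ℝ :=
  1 / lam Φ ^ n * c Φ n α β

/-! ### Words in two letters and the operators `ω_r`, `ϑ_r` -/

/-- The two letters. -/
inductive AB : Type
  | a
  | b
  deriving DecidableEq

/-- The space of (noncommutative) polynomials in the letters `a`, `b`; the words form a basis. -/
abbrev ABAlg : Type := MonoidAlgebra ℝ (FreeMonoid AB)

/-- A word as a polynomial. -/
def word (u : List AB) : ABAlg := MonoidAlgebra.single (FreeMonoid.ofList u) 1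

/-- The letter `a` as a polynomial. -/
def pa : ABAlg := word [AB.a]

/-- The letter `b` as a polynomial. -/
def pb : ABAlg := word [AB.b]

/-- `ω_r` on a word: every factor `ab` is replaced by `r (ab + (r-1) ba)`, every remaining `a` by
`a + (r-1) b` and every remaining `b` by `b + (r-1) a`. -/
def omegaWord (r : ℝ) : List AB → ABAlg
  | [] => 1
  | AB.a :: AB.b :: u => r • (pa * pb + (r - 1) • (pb * pa)) * omegaWord r u
  | AB.a :: u => (pa + (r - 1) • pb) * omegaWord r u
  | AB.b :: u => (pb + (r - 1) • pa) * omegaWord r u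

/-- The linear operator `ω_r`. -/
def omega (r : ℝ) : ABAlg →ₗ[ℝ] ABAlg :=
  (MonoidAlgebra.basis (FreeMonoid AB) ℝ).constr ℝ fun u => omegaWord r (FreeMonoid.toList u)

/-- The set of positions of the letter `b` in a word. -/
def positions (u : List AB) : Finset (Fin u.length) :=
  Finset.univ.filter fun i => u.get i = AB.b

/-- The linear map `γ` sending a word `u` of length `m` to `F_{co(S_u)}`, where `co(S_u)` is a
composition of `m + 1`. -/
def gam : ABAlg →ₗ[ℝ] QSym :=
  (MonoidAlgebra.basis (FreeMonoid AB) ℝ).constr ℝ fun u =>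
    F ⟨(FreeMonoid.toList u).length + 1,
      co ((FreeMonoid.toList u).length + 1) (positions (FreeMonoid.toList u))⟩

/-- The word `u` with `co(S_u) = α`. -/
def wordOf {m : ℕ} (α : Composition (m + 1)) : List AB :=
  List.ofFn fun i : Fin m => if i ∈ cutSet (m + 1) α then AB.b else AB.a

/-- The linear operator `ϑ_r`: it is `γ ∘ (r ω_r) ∘ γ⁻¹` in positive degrees, and it fixes `1`. -/
def theta (r : ℝ) : QSym →ₗ[ℝ] QSym :=
  basisF.constr ℝ fun α =>
    match α with
    | ⟨0, α⟩ => F ⟨0, α⟩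
    | ⟨_ + 1, α⟩ => gam (r • omega r (word (wordOf α)))

theorem theta_F_zero (r : ℝ) (α : Composition 0) : theta r (F ⟨0, α⟩) = F ⟨0, α⟩ := by
  have : F ⟨0, α⟩ = basisF ⟨0, α⟩ := by simp [basisF]
  conv_lhs => rw [this, theta, Module.Basis.constr_basis]

theorem coe_F_zero (α : Composition 0) : ((F ⟨0, α⟩ : QSym) : MvPowerSeries ℕ ℝ) = 1 := by
  have h1 : (F ⟨0, α⟩ : QSym) = M ⟨0, α⟩ := by
    simp only [F]
    rw [Finset.sum_eq_single α]
    · intro b _ hb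
      have : Subsingleton (Finset (Fin (0 - 1))) := inferInstanceAs (Subsingleton (Finset (Fin 0)))
      have : Subsingleton (Composition 0) := (cutSet 0).subsingleton
      exact absurd (Subsingleton.elim _ _) hb
    · intro h
      simp at h
  rw [h1]
  ext m
  show monoSeries ⟨0, α⟩ m = _
  rw [MvPowerSeries.coeff_one]
  have hα : α.blocks = [] := by
    have := α.blocks_sum
    rw [List.eq_nil_iff_forall_not_mem]
    intro x hx
    have h2 := List.le_sum_of_mem hx
    have h3 := α.blocks_pos hx
    omega
  have hs : m.support.sort (· ≤ ·) = [] ↔ m = 0 := by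
    rw [← List.length_eq_zero_iff, Finset.length_sort, Finset.card_eq_zero,
      Finsupp.support_eq_empty]
  simp [monoSeries, hα, exponents, hs]

theorem wordOf_co (u : List AB) : wordOf (co (u.length + 1) (positions u)) = u := by
  have : (fun i : Fin u.length =>
      if i ∈ cutSet (u.length + 1) (co (u.length + 1) (positions u)) then AB.b else AB.a)
      = u.get := by
    funext i
    simp only [co, Equiv.apply_symm_apply]
    have hmem : i ∈ positions u ↔ u.get i = AB.b := by simp [positions]
    by_cases h : u.get i = AB.b
    · rw [if_pos (hmem.2 h), h]
    · rw [if_neg (fun h' => h (hmem.1 h'))]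
      cases hu : u.get i
      · rfl
      · exact absurd hu h
  rw [wordOf, this, List.ofFn_get]

/-- The defining property of `ϑ_r` in positive degrees. -/
theorem theta_gam (r : ℝ) (P : ABAlg) : theta r (gam P) = gam (r • omega r P) := by
  have : (theta r).comp gam = gam.comp (r • omega r) := by
    refine (MonoidAlgebra.basis (FreeMonoid AB) ℝ).ext fun u => ?_
    have h1 : ∀ α, F α = basisF α := by intro α; simp [basisF]
    rw [LinearMap.comp_apply, gam, Module.Basis.constr_basis, h1, theta,
      Module.Basis.constr_basis]
    simp only [wordOf_co]
    rfl
  exact LinearMap.congr_fun this P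

theorem lam_theta (r : ℝ) : lam (theta r) = r := by
  apply lam_eq
  have h : M ⟨1, onePart 1⟩ = gam (word []) := by
    rw [M_one_eq_F_one, word, ← MonoidAlgebra.basis_apply, gam, Module.Basis.constr_basis]
    congr 1
  have h2 : omega r (word []) = word [] := by
    conv_lhs => rw [word, ← MonoidAlgebra.basis_apply, omega, Module.Basis.constr_basis]
    rfl
  rw [h, theta_gam, h2, map_smul]

/-! ### Stembridge's map -/

/-- The peak set `Λ(α) = {i ∈ S_α : i ≠ 1, i - 1 ∉ S_α}`. -/
def peaks (n : ℕ) (α : Composition n) : Finset (Fin (n - 1)) :=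
  (cutSet n α).filter fun i => (i : ℕ) ≠ 0 ∧ ∀ j ∈ cutSet n α, (j : ℕ) + 1 ≠ i

/-- The condition `Λ(α) ⊆ S_β ∆ (S_β + 1)`. -/
def PeakCompatible (n : ℕ) (α β : Composition n) : Prop :=
  ∀ i ∈ peaks n α, Xor (i ∈ cutSet n β) (∃ j ∈ cutSet n β, (j : ℕ) + 1 = i)

open Classical in
/-- Stembridge's map: `Θ(1) = 1` and, in positive degree,
`Θ(F_α) = 2 ^ (|Λ(α)| + 1) ∑ F_β`, the sum being over the `β` with `Λ(α) ⊆ S_β ∆ (S_β + 1)`. -/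
def stembridgeTheta : QSym →ₗ[ℝ] QSym :=
  basisF.constr ℝ fun α =>
    if α.1 = 0 then F α
    else (2 : ℝ) ^ ((peaks α.1 α.2).card + 1) •
      ∑ β : Composition α.1 with PeakCompatible α.1 α.2 β, F ⟨α.1, β⟩

end QuasiSym

end

/-!
Let `u` be the descent word of `σ` (letter `b` at a descent, `a` at an ascent). In the signed
sequence `(δ₁ σ₁, …, δₙ σₙ)` the comparison of the entries `i` and `i + 1` depends only on the sign
of the one with larger absolute value: on `δ_{i+1}` if `σ` ascends at `i`, on `δ_i` if it descends.
So two comparisons use the same sign exactly when they form a factor `ab` of `u`. Such a factor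
stays `ab` with probability `1 / r` and becomes `ba` otherwise, while every other letter is kept
with probability `1 / r` and switched otherwise, all independently. These are the replacement
rules of `ω_r` divided by `r ^ (n - 1)` (`coeff_omegaWord`), whence the formula `c_theta_D` for the
coefficients `c_{D(σ),β}` of `ϑ_r` and the claim on the matrix `K̄` (`Kbar_theta`). The induction on
words behind `coeff_omegaWord` reads the signs from left to right and remembers the last one
(`transfer`).

For the walk on permutations, `c_{D(π),(n)}` is `r ^ n` times the probability that the signed
sequence of `π` increases. For `π = σ τ⁻¹`, permuting the independent signs by `τ⁻¹` turns this
event into the event that the signed sequence of `σ` standardizes to `τ`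
(`signProb_monotone_mul_inv`). With `σ = 1`, summing over `τ` evaluates the denominator of
`Prob_Φ` as `r ^ n`, and `K_theta` follows.

For `r = 2` the rules replace each `ab` by `2 (ab + ba)` and every other letter by `a + b`. As the
factors `ab` of `u` are the peaks of `σ`, the operator `2 ω₂` is Stembridge's operator
(`c_stembridgeTheta`).
-/

namespace QuasiSym

/-! ### Coefficients of `ϑ_r` and of `ω_r` -/

theorem basisF_apply (α : Comp) : basisF α = F α := by simp [basisF]

theorem omega_word (r : ℝ) (u : List AB) : omega r (word u) = omegaWord r u := by
  rw [word, ← MonoidAlgebra.basis_apply, omega, Module.Basis.constr_basis, FreeMonoid.toList_ofList]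

theorem gam_word (u : List AB) :
    gam (word u) = F ⟨u.length + 1, co (u.length + 1) (positions u)⟩ := by
  rw [word, ← MonoidAlgebra.basis_apply, gam, Module.Basis.constr_basis]
  rfl

theorem gam_wordOf {m : ℕ} (α : Composition (m + 1)) : gam (word (wordOf α)) = F ⟨m + 1, α⟩ := by
  rw [gam_word]
  congr 1
  -- The length of `wordOf α` equals `m` only propositionally, so `m` is generalized to `k`.
  have key : ∀ (k : ℕ) (hk : k = m) (S : Finset (Fin k)),
      (∀ i : Fin k, i ∈ S ↔ (i.cast hk : Fin m) ∈ cutSet (m + 1) α) →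
      (⟨k + 1, co (k + 1) S⟩ : Comp) = ⟨m + 1, α⟩ := by
    rintro k rfl S hS
    have : S = cutSet (k + 1) α := by
      ext i
      exact hS i
    rw [this, co, Equiv.symm_apply_apply]
  refine key _ (by simp [wordOf]) _ fun i => ?_
  have hi : (wordOf α).get i
      = if i.cast (by simp [wordOf]) ∈ cutSet (m + 1) α then AB.b else AB.a :=
    List.getElem_ofFn _
  rw [positions, Finset.mem_filter_univ, hi]
  simp

theorem wordOf_injective {m : ℕ} : Function.Injective (wordOf (m := m)) := by
  intro α β h
  have h2 := congrArg (fun u => gam (word u)) h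
  simp only [gam_wordOf] at h2
  simpa using F_linearIndependent.injective h2

theorem repr_gam {m : ℕ} (P : ABAlg) (β : Composition (m + 1)) :
    basisF.repr (gam P) ⟨m + 1, β⟩ = P.coeff (FreeMonoid.ofList (wordOf β)) := by
  have : (basisF.coord ⟨m + 1, β⟩).comp gam
      = (MonoidAlgebra.basis (FreeMonoid AB) ℝ).coord (FreeMonoid.ofList (wordOf β)) := by
    refine (MonoidAlgebra.basis (FreeMonoid AB) ℝ).ext fun w => ?_
    obtain ⟨u, rfl⟩ := FreeMonoid.ofList.surjective w
    have hw : MonoidAlgebra.basis (FreeMonoid AB) ℝ (FreeMonoid.ofList u) = word u := by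
      rw [MonoidAlgebra.basis_apply, word]
    rw [Module.Basis.coord_apply, Module.Basis.repr_self, LinearMap.comp_apply, hw, gam_word,
      ← basisF_apply, Module.Basis.coord_apply, Module.Basis.repr_self]
    classical
    rw [Finsupp.single_apply, Finsupp.single_apply]
    refine if_congr ⟨fun h => ?_, fun h => ?_⟩ rfl rfl
    · obtain ⟨h1, h2⟩ := Sigma.mk.inj h
      obtain rfl : u.length = m := by omega
      rw [← eq_of_heq h2, wordOf_co]
    · obtain rfl := FreeMonoid.ofList.injective h
      apply F_linearIndependent.injective
      rw [← gam_word, gam_wordOf]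
  exact LinearMap.congr_fun this P

/-- The numbers `c_{α,β}` of `ϑ_r` are, up to the factor `r`, the coefficients of `ω_r`. -/
theorem c_theta (r : ℝ) {m : ℕ} (α β : Composition (m + 1)) :
    c (theta r) (m + 1) α β
      = r * (omegaWord r (wordOf α)).coeff (FreeMonoid.ofList (wordOf β)) := by
  rw [c, ← gam_wordOf α, theta_gam, repr_gam, omega_word]
  simp

/-! ### The operator `ω_r` as a law of random words -/

theorem coeff_word_singleton_mul_cons (x y : AB) (v : List AB) (P : ABAlg) :
    (word [x] * P).coeff (FreeMonoid.ofList (y :: v))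
      = if x = y then P.coeff (FreeMonoid.ofList v) else 0 := by
  rw [word, FreeMonoid.ofList_singleton]
  split_ifs with h
  · subst h
    rw [FreeMonoid.ofList_cons,
      MonoidAlgebra.coeff_single_mul_eq_mul_coeff (FreeMonoid.ofList v), one_mul]
    intro a _
    exact mul_right_inj _
  · refine MonoidAlgebra.coeff_single_mul_of_forall_mul_ne _ _ fun d hd => ?_
    have := congrArg FreeMonoid.toList hd
    simp at this
    exact h this.1

theorem coeff_word_singleton_mul_nil (x : AB) (P : ABAlg) :
    (word [x] * P).coeff (FreeMonoid.ofList []) = 0 := by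
  rw [word, FreeMonoid.ofList_singleton]
  refine MonoidAlgebra.coeff_single_mul_of_forall_mul_ne _ _ fun d hd => ?_
  have := congrArg FreeMonoid.toList hd
  simp at this

/-- The probability of a sign, `true` standing for `1` and `false` for `-1`. -/
noncomputable def wt (r : ℝ) (e : Bool) : ℝ := if e then 1 / r else 1 - 1 / r

open Classical in
/-- The probability of an event `Q` for `n` independent signs, each equal to `1` with
probability `1 / r` and to `-1` with probability `1 - 1 / r`, as a finite sum over the signs. -/
noncomputable def signProb (r : ℝ) (n : ℕ) (Q : (Fin n → Bool) → Prop) : ℝ :=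
  ∑ ε : Fin n → Bool, if Q ε then ∏ i, wt r (ε i) else 0

theorem signProb_congr {r : ℝ} {n : ℕ} {Q Q' : (Fin n → Bool) → Prop} (h : ∀ ε, Q ε ↔ Q' ε) :
    signProb r n Q = signProb r n Q' := by
  rw [show Q = Q' from funext fun ε => propext (h ε)]

/-- The comparison (`b` for a descent, `a` for an ascent) of two consecutive entries of a signed
sequence, in terms of the comparison `x` of the absolute values and of the signs `e`, `e'`: it is
the sign of the entry of larger absolute value that decides. -/
def outcome (x : AB) (e e' : Bool) : AB :=
  match x with
  | AB.a => if e' then AB.a else AB.b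
  | AB.b => if e then AB.b else AB.a

/-- The probability that a sequence whose absolute values have descent word `u`, whose first sign is
`e` and whose other signs are random, has descent word `v`; it is `0` if the lengths of `u` and `v`
differ. -/
noncomputable def transfer (r : ℝ) : List AB → List AB → Bool → ℝ
  | [], [], _ => 1
  | c :: u, x :: v, e => ∑ e' : Bool, if outcome c e e' = x then wt r e' * transfer r u v e' else 0
  | [], _ :: _, _ => 0
  | _ :: _, [], _ => 0

/-- An initial ascent does not involve the first sign. -/
theorem transfer_a (r : ℝ) (u v : List AB) (e : Bool) :
    transfer r (AB.a :: u) v e = transfer r (AB.a :: u) v true := by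
  cases v <;> simp [transfer, outcome]

/-- The coefficient of `v` in `ω_r(u)` is, up to a power of `r`, the probability that random signs
turn the descent word `u` into `v`. -/
theorem coeff_omegaWord {r : ℝ} (hr : r ≠ 0) (u v : List AB) :
    (omegaWord r u).coeff (FreeMonoid.ofList v)
      = r ^ u.length * ∑ e : Bool, wt r e * transfer r u v e := by
  induction u using omegaWord.induct generalizing v with
  | case1 =>
    cases v with
    | nil => simp [omegaWord, transfer, wt, MonoidAlgebra.one_def]
    | cons y v => simp [omegaWord, transfer, MonoidAlgebra.one_def]
  | case2 u ih =>
    rw [omegaWord]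
    simp only [pa, pb, add_mul, smul_mul_assoc, mul_assoc, smul_add, MonoidAlgebra.coeff_add,
      MonoidAlgebra.coeff_smul, Finsupp.add_apply, Finsupp.smul_apply, smul_eq_mul]
    rcases v with _ | ⟨x, _ | ⟨y, v⟩⟩
    · simp only [coeff_word_singleton_mul_nil, transfer]
      simp
    · simp only [coeff_word_singleton_mul_nil, coeff_word_singleton_mul_cons, transfer]
      simp
    · simp only [coeff_word_singleton_mul_cons, ih, transfer, outcome]
      cases x <;> cases y <;> simp [wt] <;> field_simp <;> ring
  | case3 u hu ih =>
    rw [omegaWord]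
    · simp only [pa, pb, add_mul, smul_mul_assoc, MonoidAlgebra.coeff_add,
        MonoidAlgebra.coeff_smul, Finsupp.add_apply, Finsupp.smul_apply, smul_eq_mul]
      rcases v with _ | ⟨x, v⟩
      · simp only [coeff_word_singleton_mul_nil, transfer]
        simp
      · -- As `u` does not begin with `b`, the sign deciding the leading `a` plays no further role.
        have hconst : transfer r u v false = transfer r u v true := by
          rcases u with _ | ⟨_ | _, u⟩
          · cases v <;> rfl
          · exact transfer_a _ _ _ _
          · exact absurd rfl (hu _)
        simp only [coeff_word_singleton_mul_cons, ih, transfer, outcome]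
        cases x <;> simp [wt, hconst] <;> field_simp <;> ring
    · exact hu
  | case4 u ih =>
    rw [omegaWord]
    simp only [pa, pb, add_mul, smul_mul_assoc, MonoidAlgebra.coeff_add,
      MonoidAlgebra.coeff_smul, Finsupp.add_apply, Finsupp.smul_apply, smul_eq_mul]
    rcases v with _ | ⟨x, v⟩
    · simp only [coeff_word_singleton_mul_nil, transfer]
      simp
    · simp only [coeff_word_singleton_mul_cons, ih, transfer, outcome]
      cases x <;> simp [wt] <;> field_simp <;> ring

theorem transfer_ofFn (r : ℝ) {m : ℕ} (u v : Fin m → AB) (e : Bool) :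
    transfer r (List.ofFn u) (List.ofFn v) e = ∑ ε : Fin m → Bool,
      if ∀ i : Fin m, outcome (u i) ((Fin.cons e ε : Fin (m + 1) → Bool) i.castSucc) (ε i) = v i
        then ∏ i, wt r (ε i) else 0 := by
  induction m generalizing e with
  | zero => simp [transfer]
  | succ m ih =>
    rw [List.ofFn_succ, List.ofFn_succ, transfer, ← (Fin.consEquiv fun _ => Bool).sum_comp,
      Fintype.sum_prod_type]
    refine Finset.sum_congr rfl fun e' _ => ?_
    rw [ih]
    split_ifs with h
    · rw [Finset.mul_sum]
      refine Finset.sum_congr rfl fun ε _ => ?_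
      rw [mul_ite, mul_zero]
      refine if_congr ?_ ?_ rfl
      · simp [Fin.forall_fin_succ, Fin.consEquiv, h]
      · simp [Fin.prod_univ_succ, Fin.consEquiv]
    · symm
      refine Finset.sum_eq_zero fun ε _ => if_neg fun h' => h ?_
      simpa [Fin.consEquiv] using h' 0

theorem sum_wt_mul_transfer_ofFn (r : ℝ) {m : ℕ} (u v : Fin m → AB) :
    ∑ e : Bool, wt r e * transfer r (List.ofFn u) (List.ofFn v) e
      = signProb r (m + 1) fun ε => ∀ i : Fin m,
          outcome (u i) (ε i.castSucc) (ε i.succ) = v i := by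
  classical
  rw [signProb, ← (Fin.consEquiv fun _ => Bool).sum_comp, Fintype.sum_prod_type]
  refine Finset.sum_congr rfl fun e _ => ?_
  rw [transfer_ofFn, Finset.mul_sum]
  refine Finset.sum_congr rfl fun ε _ => ?_
  rw [mul_ite, mul_zero]
  congr 1
  simp [Fin.prod_univ_succ, Fin.consEquiv]

/-! ### Independent signs -/

/-- The integer sign encoded by a Boolean. -/
def sgn (e : Bool) : ℤ := if e then 1 else -1

theorem signProb_comp_perm (r : ℝ) {n : ℕ} (π : Equiv.Perm (Fin n)) (Q : (Fin n → Bool) → Prop) :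
    signProb r n (fun ε => Q (ε ∘ π)) = signProb r n Q := by
  classical
  rw [signProb, signProb, ← (Equiv.arrowCongr π (Equiv.refl Bool)).sum_comp]
  refine Finset.sum_congr rfl fun ε _ => ?_
  have hε : Equiv.arrowCongr π (Equiv.refl Bool) ε ∘ π = ε := by
    funext i
    simp
  refine if_congr (by rw [hε]) ?_ rfl
  rw [← Equiv.prod_comp π]
  exact Finset.prod_congr rfl fun i _ => congrArg (wt r) (congrFun hε i)

theorem signProb_true (r : ℝ) (n : ℕ) : signProb r n (fun _ => True) = 1 := by
  have := Finset.prod_univ_sum (fun _ : Fin n => (Finset.univ : Finset Bool)) (fun _ e => wt r e)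
  simp only [Fintype.piFinset_univ] at this
  simp only [signProb, if_true, ← this]
  simp [wt]

theorem sum_signProb_eq (r : ℝ) {n : ℕ} {ι : Type*} [Fintype ι] (f : (Fin n → Bool) → ι) :
    ∑ τ : ι, signProb r n (fun ε => f ε = τ) = 1 := by
  classical
  rw [← signProb_true r n]
  simp only [signProb]
  rw [Finset.sum_comm]
  simp

/-- The probability of any event defined by the random signs is the finite sum `signProb`: almost
surely every `δ i` is `1` or `-1`, since the two probabilities add up to `1`. -/
theorem signProb_of_iIndepFun {Ω : Type*} [MeasurableSpace Ω] (P : Measure Ω)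
    [IsProbabilityMeasure P] (n : ℕ) (r : ℝ) (δ : Fin n → Ω → ℤ)
    (hmeas : ∀ i, Measurable (δ i)) (hindep : iIndepFun δ P)
    (hpos : ∀ i, P.real {ω | δ i ω = 1} = 1 / r)
    (hneg : ∀ i, P.real {ω | δ i ω = -1} = 1 - 1 / r) (Q : (Fin n → ℤ) → Prop) :
    P.real {ω | Q fun i => δ i ω} = signProb r n fun ε => Q fun i => sgn (ε i) := by
  classical
  let A : (Fin n → Bool) → Set Ω := fun ε => ⋂ i ∈ Finset.univ, δ i ⁻¹' {sgn (ε i)}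
  have hA : ∀ ε ω, ω ∈ A ε ↔ ∀ i, δ i ω = sgn (ε i) := by simp [A]
  have hAm : ∀ ε, MeasurableSet (A ε) := fun ε =>
    Finset.measurableSet_biInter _ fun i _ => hmeas i (measurableSet_singleton _)
  have hAP : ∀ ε, P.real (A ε) = ∏ i, wt r (ε i) := by
    intro ε
    rw [measureReal_def, hindep.measure_inter_preimage_eq_mul _ (fun i _ =>
      measurableSet_singleton _), ENNReal.toReal_prod]
    refine Finset.prod_congr rfl fun i _ => ?_
    cases h : ε i
    · exact hneg i
    · exact hpos i
  have hae : ∀ᵐ ω ∂P, ∀ i, δ i ω = 1 ∨ δ i ω = -1 := by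
    rw [ae_all_iff]
    intro i
    have hm1 : MeasurableSet {ω | δ i ω = 1} := hmeas i (measurableSet_singleton _)
    have hm2 : MeasurableSet {ω | δ i ω = -1} := hmeas i (measurableSet_singleton _)
    have hdisj : Disjoint {ω | δ i ω = 1} {ω | δ i ω = -1} := by
      rw [Set.disjoint_left]
      intro ω h1 h2
      rw [Set.mem_ofPred_eq] at h1 h2
      omega
    have h1 : P.real ({ω | δ i ω = 1} ∪ {ω | δ i ω = -1}) = 1 := by
      rw [measureReal_union hdisj hm2, hpos, hneg]
      ring
    have h2 : P ({ω | δ i ω = 1} ∪ {ω | δ i ω = -1}) = 1 := by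
      rwa [measureReal_def, ENNReal.toReal_eq_one_iff] at h1
    exact (prob_compl_eq_zero_iff (hm1.union hm2)).2 h2
  have hset : {ω | Q fun i => δ i ω} =ᵐ[P]
      ⋃ ε ∈ Finset.univ.filter (fun ε : Fin n → Bool => Q fun i => sgn (ε i)), A ε := by
    filter_upwards [hae] with ω hω
    refine propext ?_
    change ω ∈ {ω | Q fun i => δ i ω} ↔
      ω ∈ ⋃ ε ∈ Finset.univ.filter (fun ε : Fin n → Bool => Q fun i => sgn (ε i)), A ε
    simp only [Set.mem_iUnion, Finset.mem_filter_univ, hA, Set.mem_ofPred_eq, exists_prop]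
    constructor
    · intro h
      have h3 : (fun i => δ i ω) = fun i => sgn (decide (δ i ω = 1)) := by
        funext i
        rcases hω i with h | h <;> simp [sgn, h]
      exact ⟨fun i => decide (δ i ω = 1), h3 ▸ h, congrFun h3⟩
    · rintro ⟨ε, h1, h2⟩
      rwa [funext h2]
  rw [measureReal_congr hset, measureReal_biUnion_finset _ fun ε _ => hAm ε]
  · simp only [hAP, signProb, Finset.sum_filter]
  · intro ε _ ε' _ hne
    rw [Function.onFun, Set.disjoint_left]
    intro ω h1 h2
    apply hne
    funext i
    have := ((hA _ _).1 h1 i).symm.trans ((hA _ _).1 h2 i)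
    revert this
    cases ε i <;> cases ε' i <;> simp [sgn]

/-! ### Signed sequences -/

theorem signedSeq_sgn_injective {n : ℕ} (ε : Fin n → Bool) (σ : Equiv.Perm (Fin n)) :
    Function.Injective (signedSeq (fun i => sgn (ε i)) σ) := by
  intro i j h
  have h2 := congrArg Int.natAbs h
  have h3 : ∀ e, (sgn e).natAbs = 1 := by decide
  simp only [signedSeq, Int.natAbs_mul, h3, one_mul] at h2
  apply σ.injective
  ext
  omega

theorem wordOf_descentComp {X : Type*} [LinearOrder X] {m : ℕ} (w : Fin (m + 1) → X) :
    wordOf (descentComp w)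
      = List.ofFn fun i : Fin m => if w i.succ < w i.castSucc then AB.b else AB.a := by
  rw [wordOf]
  congr 1
  funext i
  refine if_congr ?_ rfl rfl
  rw [descentComp, co, Equiv.apply_symm_apply, descents]
  exact Finset.mem_filter_univ _

theorem outcome_eq_ite {x y : ℕ} (h : x ≠ y) (e e' : Bool) :
    outcome (if y < x then AB.b else AB.a) e e'
      = if sgn e' * ((y : ℤ) + 1) < sgn e * ((x : ℤ) + 1) then AB.b else AB.a := by
  rcases lt_or_gt_of_ne h with h | h <;> cases e <;> cases e' <;>
    simp [outcome, sgn, h, h.not_gt] <;> omega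

theorem descentComp_eq_onePart_iff {X : Type*} [LinearOrder X] {n : ℕ} (w : Fin n → X) :
    descentComp w = onePart n ↔ Monotone w := by
  rw [descentComp, onePart, co, co, (cutSet n).symm.injective.eq_iff, descents,
    Finset.filter_eq_empty_iff]
  cases n with
  | zero => exact ⟨fun _ i => i.elim0, fun _ i => i.elim0⟩
  | succ m =>
    rw [Fin.monotone_iff_le_succ]
    exact ⟨fun h i => not_lt.1 (h (Finset.mem_univ i)), fun h i _ => not_lt.2 (h i)⟩

theorem st_eq_iff_monotone {X : Type*} [LinearOrder X] {n : ℕ} {w : Fin n → X}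
    (hw : Function.Injective w) (τ : Equiv.Perm (Fin n)) :
    st w = τ ↔ Monotone (w ∘ (τ⁻¹ : Equiv.Perm (Fin n))) := by
  rw [st_eq_iff hw]
  constructor
  · intro h i j hij
    rw [Function.comp_apply, Function.comp_apply, ← not_lt, h]
    simpa using hij
  · intro h i j
    have h2 := (h.strictMono_of_injective (hw.comp (τ⁻¹).injective)).lt_iff_lt (a := τ i) (b := τ j)
    simpa using h2

/-! ### The transition matrices of `ϑ_r` -/

theorem c_theta_D (r : ℝ) (hr : r ≠ 0) (n : ℕ) (σ : Equiv.Perm (Fin n)) (β : Composition n) :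
    c (theta r) n (D σ) β = r ^ n * signProb r n fun ε =>
      descentComp (signedSeq (fun i => sgn (ε i)) σ) = β := by
  cases n with
  | zero =>
    have : Subsingleton (Finset (Fin (0 - 1))) := inferInstanceAs (Subsingleton (Finset (Fin 0)))
    have : Subsingleton (Composition 0) := (cutSet 0).subsingleton
    rw [signProb_congr fun ε => iff_true_intro (Subsingleton.elim _ _), signProb_true, c,
      theta_F_zero, ← basisF_apply, Subsingleton.elim (D σ) β]
    simp
  | succ m =>
    rw [c_theta, coeff_omegaWord hr, D, wordOf_descentComp, wordOf, sum_wt_mul_transfer_ofFn,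
      List.length_ofFn, ← mul_assoc, ← pow_succ']
    congr 1
    refine signProb_congr fun ε => ?_
    rw [← wordOf_injective.eq_iff, wordOf_descentComp, wordOf, List.ofFn_inj, funext_iff]
    refine forall_congr' fun i => ?_
    have hne : (σ i.castSucc : ℕ) ≠ σ i.succ := fun h =>
      (Fin.castSucc_lt_succ (i := i)).ne (σ.injective (Fin.ext h))
    exact Eq.congr_left (outcome_eq_ite hne _ _)

/-- Permuting the independent signs turns the event that `σ τ⁻¹` is sorted by its signs into the
event that the signed sequence of `σ` standardizes to `τ`. -/
theorem signProb_monotone_mul_inv (r : ℝ) {n : ℕ} (σ τ : Equiv.Perm (Fin n)) :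
    signProb r n (fun ε => Monotone (signedSeq (fun i => sgn (ε i)) (σ * τ⁻¹)))
      = signProb r n (fun ε => st (signedSeq (fun i => sgn (ε i)) σ) = τ) := by
  rw [← signProb_comp_perm r τ⁻¹]
  exact signProb_congr fun ε => (st_eq_iff_monotone (signedSeq_sgn_injective ε σ) τ).symm

theorem c_theta_D_onePart (r : ℝ) (hr : r ≠ 0) {n : ℕ} (σ τ : Equiv.Perm (Fin n)) :
    c (theta r) n (D (σ * τ⁻¹)) (onePart n)
      = r ^ n * signProb r n (fun ε => st (signedSeq (fun i => sgn (ε i)) σ) = τ) := by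
  rw [c_theta_D r hr, ← signProb_monotone_mul_inv]
  congr 1
  exact signProb_congr fun ε => descentComp_eq_onePart_iff _

theorem sum_c_theta_onePart (r : ℝ) (hr : r ≠ 0) (n : ℕ) :
    ∑ σ : Equiv.Perm (Fin n), c (theta r) n (D σ) (onePart n) = r ^ n := by
  -- Summing over `τ⁻¹` makes the summands the probabilities that a fixed sequence standardizes
  -- to `τ`.
  rw [← Equiv.sum_comp (Equiv.inv (Equiv.Perm (Fin n)))]
  have h (τ : Equiv.Perm (Fin n)) := c_theta_D_onePart r hr 1 τ
  simp only [one_mul] at h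
  simp only [Equiv.inv_apply, h, ← Finset.mul_sum, sum_signProb_eq, mul_one]

theorem K_theta (r : ℝ) (hr : r ≠ 0) (n : ℕ) (σ τ : Equiv.Perm (Fin n)) :
    K (theta r) n σ τ
      = signProb r n (fun ε => st (signedSeq (fun i => sgn (ε i)) σ) = τ) := by
  rw [K, prob, sum_c_theta_onePart r hr, mul_inv_rev, inv_inv, c_theta_D_onePart r hr,
    mul_div_cancel_left₀ _ (pow_ne_zero n hr)]

theorem Kbar_theta (r : ℝ) (hr : r ≠ 0) (n : ℕ) (σ : Equiv.Perm (Fin n)) (β : Composition n) :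
    Kbar (theta r) n (D σ) β
      = signProb r n (fun ε => descentComp (signedSeq (fun i => sgn (ε i)) σ) = β) := by
  rw [Kbar, lam_theta, c_theta_D r hr, ← mul_assoc, one_div,
    inv_mul_cancel₀ (pow_ne_zero n hr), one_mul]

/-! ### Stembridge's operator -/

/-- For words of equal length, `2 ^ k` if `u` has `k` factors `ab` and at each of them the two
letters of `v` differ, and `0` if they agree at some factor `ab` of `u`. -/
def peakWeight : List AB → List AB → ℝ
  | c :: c' :: u, x :: y :: v =>
      (if c = AB.a ∧ c' = AB.b then (if x = y then 0 else 2) else 1) * peakWeight (c' :: u) (y :: v)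
  | _, _ => 1

/-- A leading `b` starts no factor `ab`. -/
theorem peakWeight_b_cons (u : List AB) (y : AB) (v : List AB) :
    peakWeight (AB.b :: u) (y :: v) = peakWeight u v := by
  rcases u with _ | ⟨c, u⟩
  · simp [peakWeight]
  · rcases v with _ | ⟨x, v⟩
    · rcases u with _ | ⟨c', u⟩ <;> simp [peakWeight]
    · simp [peakWeight]

theorem coeff_omegaWord_two (u v : List AB) (h : u.length = v.length) :
    (omegaWord 2 u).coeff (FreeMonoid.ofList v) = peakWeight u v := by
  induction u using omegaWord.induct generalizing v with
  | case1 =>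
    obtain rfl : v = [] := List.length_eq_zero_iff.1 h.symm
    simp [omegaWord, peakWeight, MonoidAlgebra.one_def]
  | case2 u ih =>
    rcases v with _ | ⟨x, _ | ⟨y, v⟩⟩
    · simp at h
    · simp at h
    · rw [omegaWord]
      simp only [pa, pb, add_mul, smul_mul_assoc, mul_assoc, smul_add, MonoidAlgebra.coeff_add,
        MonoidAlgebra.coeff_smul, Finsupp.add_apply, Finsupp.smul_apply, smul_eq_mul,
        coeff_word_singleton_mul_cons, ih v (by simpa using h), peakWeight, peakWeight_b_cons]
      cases x <;> cases y <;> simp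
      norm_num
  | case3 u hu ih =>
    rcases v with _ | ⟨x, v⟩
    · simp at h
    · rw [omegaWord]
      · have h2 : peakWeight (AB.a :: u) (x :: v) = peakWeight u v := by
          rcases u with _ | ⟨_ | _, u⟩
          · simp [peakWeight]
          · cases v <;> simp [peakWeight]
          · exact absurd rfl (hu _)
        simp only [pa, pb, add_mul, smul_mul_assoc, MonoidAlgebra.coeff_add,
          MonoidAlgebra.coeff_smul, Finsupp.add_apply, Finsupp.smul_apply, smul_eq_mul,
          coeff_word_singleton_mul_cons, ih v (by simpa using h), h2]
        cases x <;> simp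
        norm_num
      · exact hu
  | case4 u ih =>
    rcases v with _ | ⟨x, v⟩
    · simp at h
    · rw [omegaWord]
      simp only [pa, pb, add_mul, smul_mul_assoc, MonoidAlgebra.coeff_add,
        MonoidAlgebra.coeff_smul, Finsupp.add_apply, Finsupp.smul_apply, smul_eq_mul,
        coeff_word_singleton_mul_cons, ih v (by simpa using h), peakWeight_b_cons]
      cases x <;> simp
      norm_num

theorem peakWeight_ofFn {m : ℕ} (u v : Fin (m + 1) → AB) :
    peakWeight (List.ofFn u) (List.ofFn v) = ∏ i : Fin m,
      if u i.castSucc = AB.a ∧ u i.succ = AB.b then (if v i.castSucc = v i.succ then 0 else 2)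
        else (1 : ℝ) := by
  induction m with
  | zero => simp [peakWeight]
  | succ m ih =>
    have := ih (fun i => u i.succ) (fun i => v i.succ)
    rw [List.ofFn_succ, List.ofFn_succ] at this
    rw [List.ofFn_succ, List.ofFn_succ, List.ofFn_succ, List.ofFn_succ, peakWeight, this,
      Fin.prod_univ_succ]
    rfl

open Classical in
/-- The peaks of `α` are the positions of the second letters of the factors `ab` of its word. -/
theorem two_pow_card_peaks_mul {m : ℕ} (α β : Composition (m + 1)) :
    (2 : ℝ) ^ (peaks (m + 1) α).card * (if PeakCompatible (m + 1) α β then 1 else 0)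
      = peakWeight (wordOf α) (wordOf β) := by
  have h1 : (2 : ℝ) ^ (peaks (m + 1) α).card * (if PeakCompatible (m + 1) α β then 1 else 0)
      = ∏ i : Fin m, if i ∈ peaks (m + 1) α then
        (if Xor (i ∈ cutSet (m + 1) β) (∃ j ∈ cutSet (m + 1) β, (j : ℕ) + 1 = i) then 2 else 0)
        else 1 := by
    rw [← Finset.prod_filter, Finset.filter_mem_eq_inter, Finset.univ_inter]
    split_ifs with h
    · rw [mul_one, ← Finset.prod_const]
      exact Finset.prod_congr rfl fun i hi => (if_pos (h i hi)).symm
    · rw [PeakCompatible] at h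
      push Not at h
      obtain ⟨i, hi, hx⟩ := h
      rw [mul_zero]
      exact (Finset.prod_eq_zero hi (if_neg hx)).symm
  rw [h1]
  cases m with
  | zero => simp [wordOf, peakWeight]
  | succ m =>
    -- In the shifted indexing `i.succ` is never the first position, and its predecessor is
    -- `i.castSucc`.
    have mem_iff : ∀ (S : Finset (Fin (m + 1))) (i : Fin m),
        (∃ j ∈ S, (j : ℕ) + 1 = (i.succ : Fin (m + 1))) ↔ i.castSucc ∈ S := by
      intro S i
      constructor
      · rintro ⟨j, hj, h⟩
        rwa [show i.castSucc = j by ext; simp at h ⊢; omega]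
      · intro h
        exact ⟨_, h, by simp⟩
    have peak_iff : ∀ i : Fin m, i.succ ∈ peaks (m + 1 + 1) α ↔
        i.castSucc ∉ cutSet (m + 1 + 1) α ∧ i.succ ∈ cutSet (m + 1 + 1) α := by
      intro i
      have h0 : ((i.succ : Fin (m + 1)) : ℕ) ≠ 0 := by simp
      rw [peaks, Finset.mem_filter, ← mem_iff]
      push Not
      tauto
    have zero_not_mem : (0 : Fin (m + 1)) ∉ peaks (m + 1 + 1) α := by simp [peaks]
    rw [wordOf, wordOf, peakWeight_ofFn, Fin.prod_univ_succ, if_neg zero_not_mem, one_mul]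
    refine Finset.prod_congr rfl fun i _ => ?_
    refine (if_congr (peak_iff i)
      (if_congr (iff_of_eq (congrArg (Xor _) (propext (mem_iff _ i)))) rfl rfl) rfl).trans ?_
    by_cases h1 : i.castSucc ∈ cutSet (m + 1 + 1) α <;>
    by_cases h2 : i.succ ∈ cutSet (m + 1 + 1) α <;>
    by_cases h3 : i.castSucc ∈ cutSet (m + 1 + 1) β <;>
    by_cases h4 : i.succ ∈ cutSet (m + 1 + 1) β <;>
    simp [h1, h2, h3, h4, Xor]

theorem stembridgeTheta_F_zero (α : Composition 0) : stembridgeTheta (F ⟨0, α⟩) = F ⟨0, α⟩ := by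
  conv_lhs => rw [← basisF_apply, stembridgeTheta, Module.Basis.constr_basis]
  simp

open Classical in
theorem stembridgeTheta_F_succ {m : ℕ} (α : Composition (m + 1)) :
    stembridgeTheta (F ⟨m + 1, α⟩) = (2 : ℝ) ^ ((peaks (m + 1) α).card + 1) •
      ∑ β : Composition (m + 1) with PeakCompatible (m + 1) α β, F ⟨m + 1, β⟩ := by
  rw [← basisF_apply, stembridgeTheta, Module.Basis.constr_basis]
  simp

/-- Stembridge's operator is `ϑ_2`. -/
theorem c_stembridgeTheta (n : ℕ) (α β : Composition n) :
    c stembridgeTheta n α β = c (theta 2) n α β := by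
  classical
  cases n with
  | zero => rw [c, c, stembridgeTheta_F_zero, theta_F_zero]
  | succ m =>
    have hlen : (wordOf α).length = (wordOf β).length := by simp [wordOf]
    rw [c_theta, coeff_omegaWord_two _ _ hlen, ← two_pow_card_peaks_mul, c, stembridgeTheta_F_succ]
    simp only [← basisF_apply, map_smul, map_sum, Module.Basis.repr_self, Finsupp.smul_apply,
      Finsupp.finsetSum_apply, Finsupp.single_apply, Sigma.mk.injEq, heq_eq_eq, true_and,
      Finset.sum_ite_eq', Finset.mem_filter_univ, smul_eq_mul]
    ring

theorem lam_stembridgeTheta : lam stembridgeTheta = 2 := by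
  rw [← lam_theta 2, lam, lam, M_one_eq_F_one]
  exact c_stembridgeTheta 1 _ _

theorem Kbar_stembridgeTheta (n : ℕ) (α β : Composition n) :
    Kbar stembridgeTheta n α β = Kbar (theta 2) n α β := by
  rw [Kbar, Kbar, lam_stembridgeTheta, lam_theta, c_stembridgeTheta]

end QuasiSym

theorem theorem7p4 {Ω : Type*} [MeasurableSpace Ω] (P : Measure Ω) [IsProbabilityMeasure P]
    (n : ℕ) (r : ℝ) (hr : 1 < r) (δ : Fin n → Ω → ℤ)
    (hmeas : ∀ i, Measurable (δ i)) (hindep : iIndepFun δ P)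
    (hpos : ∀ i, P.real {ω | δ i ω = 1} = 1 / r)
    (hneg : ∀ i, P.real {ω | δ i ω = -1} = 1 - 1 / r) :
    (∀ σ τ : Equiv.Perm (Fin n),
      QuasiSym.K (QuasiSym.theta r) n σ τ =
        P.real {ω | QuasiSym.st (QuasiSym.signedSeq (fun i => δ i ω) σ) = τ}) ∧
    (∀ (σ : Equiv.Perm (Fin n)) (β : Composition n),
      QuasiSym.Kbar (QuasiSym.theta r) n (QuasiSym.D σ) β =
        P.real {ω | QuasiSym.descentComp (QuasiSym.signedSeq (fun i => δ i ω) σ) = β}) ∧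
    (r = 2 → ∀ (σ : Equiv.Perm (Fin n)) (β : Composition n),
      QuasiSym.Kbar QuasiSym.stembridgeTheta n (QuasiSym.D σ) β =
        P.real {ω | QuasiSym.descentComp (QuasiSym.signedSeq (fun i => δ i ω) σ) = β}) := by
  have hr0 : r ≠ 0 := by linarith
  refine ⟨fun σ τ => ?_, fun σ β => ?_, ?_⟩
  · rw [QuasiSym.K_theta r hr0]
    exact (QuasiSym.signProb_of_iIndepFun P n r δ hmeas hindep hpos hneg
      fun s => QuasiSym.st (QuasiSym.signedSeq s σ) = τ).symm
  · rw [QuasiSym.Kbar_theta r hr0]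
    exact (QuasiSym.signProb_of_iIndepFun P n r δ hmeas hindep hpos hneg
      fun s => QuasiSym.descentComp (QuasiSym.signedSeq s σ) = β).symm
  · rintro rfl σ β
    rw [QuasiSym.Kbar_stembridgeTheta, QuasiSym.Kbar_theta 2 hr0]
    exact (QuasiSym.signProb_of_iIndepFun P n 2 δ hmeas hindep hpos hneg
      fun s => QuasiSym.descentComp (QuasiSym.signedSeq s σ) = β).symm
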